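/- Let $B$ be a separable real Banach space with the approximation property, i.e. for every compact $K\subseteq B$ and every $\varepsilon>0$ there is a bounded linear operator $F:B\to B$ of finite rank with $\|x-Fx\|<\varepsilon$ for all $x\in K$. Let $k\ge 1$ be an integer, and let $X$ and $Y$ be $B$-valued random variables, defined on probability spaces that may be different, with $\mathbb E\|X\|^k<\infty$ and $\mathbb E\|Y\|^k<\infty$. Let $B^{\hat\otimes_\pi k}$ be the $k$-fold projective tensor power of $B$, i.e. the completion of the algebraic tensor power $B^{\otimes k}$ in the norm $\|u\|_\pi=\inf\sum_j\|x_{1j}\|\cdots\|x_{kj}\|$, the infimum being over all finite representations $u=\sum_j x_{1j}\otimes\cdots\otimes x_{kj}$. The projective $k$-th moment of $X$ is the Bochner integral $\mathbb E X^{\hat\otimes_\pi k}=\mathbb E(X\otimes\cdots\otimes X)\in B^{\hat\otimes_\pi k}$, and the weak $k$-th moment of $X$ is the function $(x_1^*,\dots,x_k^*)\mapsto\mathbb E\bigl(x_1^*(X)\cdots x_k^*(X)\bigr)$ on $(B^*)^k$. Then all the expectations in this statement exist, and 1. one has $$\mathbb E\,\alpha(X,\dots,X)=\mathbb E\,\alpha(Y,\dots,Y)\quad\text{for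 every bounded $k$-linear form }\alpha:B^k\to\mathbb R$$ if and only if $$\mathbb E\bigl(x_1^*(X)\cdots x_k^*(X)\bigr)=\mathbb E\bigl(x_1^*(Y)\cdots x_k^*(Y)\bigr)\quad\text{for all }x_1^*,\dots,x_k^*\in B^*;$$ 2. $X$ and $Y$ have the same projective $k$-th moment, $\mathbb E X^{\hat\otimes_\pi k}=\mathbb E Y^{\hat\otimes_\pi k}$, if and only if they have the same weak $k$-th moment. -/

import Mathlib

open MeasureTheory
open scoped TensorProduct

noncomputable section

namespace BanachMoments

section ApproximationProperty

variable {B₁ B₂ : Type*} [NormedAddCommGroup B₁] [NormedSpace ℝ B₁]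
  [NormedAddCommGroup B₂] [NormedSpace ℝ B₂]

/-- A finite rank operator: a continuous linear operator whose range has finite dimension. -/
def IsFiniteRank (F : B₁ →L[ℝ] B₂) : Prop :=
  FiniteDimensional ℝ (LinearMap.range (F : B₁ →ₗ[ℝ] B₂))

/-- `T` is approximable by finite rank operators uniformly on every compact set. -/
def IsApproximableOnCompacts (T : B₁ →L[ℝ] B₂) : Prop :=
  ∀ K : Set B₁, IsCompact K → ∀ ε : ℝ, 0 < ε →
    ∃ F : B₁ →L[ℝ] B₂, IsFiniteRank F ∧ ∀ x ∈ K, ‖T x - F x‖ < ε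

end ApproximationProperty

/-- The (Grothendieck) approximation property: the identity operator can be approximated by finite
rank operators, uniformly on compact sets. -/
def HasApproximationProperty (B : Type*) [NormedAddCommGroup B] [NormedSpace ℝ B] : Prop :=
  IsApproximableOnCompacts (ContinuousLinearMap.id ℝ B)

/-- The projective tensor power of `B`: the completion of the algebraic tensor power
`B ⊗ ⋯ ⊗ B` (`k` factors) for the projective tensor norm, which is the norm that Mathlib puts on
`PiTensorProduct`. -/
abbrev ProjTensorPower (k : ℕ) (B : Type*) [NormedAddCommGroup B] [NormedSpace ℝ B] : Type _ :=
  UniformSpace.Completion (⨂[ℝ] _ : Fin k, B)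

section Moments

variable {B : Type*} [NormedAddCommGroup B] [NormedSpace ℝ B]

/-- The elementary tensor `x ⊗ ⋯ ⊗ x` (`k` factors) in the projective tensor power. -/
def tensorPow (k : ℕ) (x : B) : ProjTensorPower k B :=
  ((⨂ₜ[ℝ] _ : Fin k, x : ⨂[ℝ] _ : Fin k, B) : UniformSpace.Completion (⨂[ℝ] _ : Fin k, B))

variable {Ω : Type*} [MeasurableSpace Ω]

/-- The projective `k`-th moment of `X`: the Bochner integral of `X ⊗ ⋯ ⊗ X` in the projective
tensor power. -/
def projMoment (k : ℕ) (P : Measure Ω) (X : Ω → B) : ProjTensorPower k B :=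
  ∫ ω, tensorPow k (X ω) ∂P

/-- The weak `k`-th moment of `X`: the function `(φ₁, …, φₖ) ↦ E (φ₁(X) ⋯ φₖ(X))` on `k`-tuples of
continuous linear functionals. -/
def weakMoment (k : ℕ) (P : Measure Ω) (X : Ω → B) : (Fin k → StrongDual ℝ B) → ℝ :=
  fun φ => ∫ ω, ∏ i, φ i (X ω) ∂P

end Moments

end BanachMoments

end

open Filter Topology

namespace BanachMoments

/-! ### Rescaling a sequence of compact sets into one totally bounded set. -/

section CompactUnion

variable {B : Type*} [NormedAddCommGroup B] [NormedSpace ℝ B]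

/-! If `F` has finite rank, `α (F x, …, F x)` is a finite combination of products of functionals, so
weak moments determine its mean. It remains to pass to the limit `F → id` under the integral. The
approximation property gives no uniform bound on operator norms, so the dominating function is built
from the law itself (`exists_dominated_seq`): tightness yields compact sets `K n` whose complements
carry very little `k`-th moment, and one application of the approximation property to the union of
shrunken copies of all `K n` yields operators whose error on `K n` grows at most like `(n + 1) * (1
+ ‖x‖)`. This growth is integrable to the power `k`. Projective moments reduce to `k`-linear forms,
since these are the functionals on the projective tensor power. -/

/-- Shrinking the members of a sequence of compact sets to the origin makes their union totally
bounded. -/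
theorem totallyBounded_iUnion_smul_image {K : ℕ → Set B} (hK : ∀ n, IsCompact (K n)) :
    TotallyBounded
      (⋃ n : ℕ, (fun x : B => (((n : ℝ) + 1) * (1 + ‖x‖))⁻¹ • x) '' K n) := by
  have hne : ∀ (n : ℕ) (x : B), ((n : ℝ) + 1) * (1 + ‖x‖) ≠ 0 := fun n x => by positivity
  have hc : ∀ n : ℕ, IsCompact ((fun x : B => (((n : ℝ) + 1) * (1 + ‖x‖))⁻¹ • x) '' K n) := by
    intro n
    refine (hK n).image ?_
    exact ((by fun_prop : Continuous fun x : B => ((n : ℝ) + 1) * (1 + ‖x‖)).inv₀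
      (hne n)).smul continuous_id
  rw [Metric.totallyBounded_iff]
  intro ε hε
  obtain ⟨N, hN⟩ := exists_nat_one_div_lt hε
  have hfin : TotallyBounded
      (⋃ n ∈ Finset.range N, (fun x : B => (((n : ℝ) + 1) * (1 + ‖x‖))⁻¹ • x) '' K n) :=
    ((Finset.range N).isCompact_biUnion fun n _ => hc n).totallyBounded
  obtain ⟨t, ht, hcov⟩ := Metric.totallyBounded_iff.1 hfin ε hε
  -- The extra centre `0` covers every set with `n ≥ N`: its points have norm at most `1 / (n + 1) <
  -- ε`.
  refine ⟨insert 0 t, ht.insert 0, ?_⟩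
  intro y hy
  obtain ⟨n, hn⟩ := Set.mem_iUnion.1 hy
  rcases lt_or_ge n N with h | h
  · have := hcov (Set.mem_biUnion (Finset.mem_coe.2 (Finset.mem_range.2 h)) hn)
    exact Set.biUnion_subset_biUnion_left (Set.subset_insert _ _) this
  · refine Set.mem_biUnion (Set.mem_insert 0 t) ?_
    obtain ⟨x, -, rfl⟩ := hn
    rw [mem_ball_zero_iff, norm_smul, norm_inv, Real.norm_of_nonneg (by positivity)]
    refine lt_of_le_of_lt ?_ hN
    have h1 : ((N : ℝ) + 1) ≤ n + 1 := by exact_mod_cast Nat.succ_le_succ h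
    rw [inv_mul_le_iff₀ (by positivity), mul_one_div, le_div_iff₀ (by positivity)]
    nlinarith [norm_nonneg x, mul_le_mul_of_nonneg_left h1 (norm_nonneg x)]

end CompactUnion

/-! ### Finite rank approximation of the identity with an integrable bound. -/

section DominatedApproximation

variable {B : Type*} [NormedAddCommGroup B] [NormedSpace ℝ B] [CompleteSpace B]

/-- Finite rank operators that approximate the identity uniformly in a scale of compact sets. -/
theorem HasApproximationProperty.exists_seq (hB : HasApproximationProperty B) {K : ℕ → Set B}
    (hK : ∀ n, IsCompact (K n)) :
    ∃ F : ℕ → B →L[ℝ] B, (∀ m, IsFiniteRank (F m)) ∧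
      ∀ m n : ℕ, ∀ x ∈ K n,
        ‖x - F m x‖ ≤ 1 / ((m : ℝ) + 1) * (((n : ℝ) + 1) * (1 + ‖x‖)) := by
  have hS := (totallyBounded_iUnion_smul_image hK).closure.isCompact_of_isClosed isClosed_closure
  choose F hF hFS using fun m : ℕ =>
    hB _ hS (1 / ((m : ℝ) + 1)) Nat.one_div_pos_of_nat
  refine ⟨F, hF, fun m n x hx => ?_⟩
  have hpos : 0 < ((n : ℝ) + 1) * (1 + ‖x‖) := by positivity
  have h := hFS m ((((n : ℝ) + 1) * (1 + ‖x‖))⁻¹ • x)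
    (subset_closure (Set.mem_iUnion.2 ⟨n, Set.mem_image_of_mem _ hx⟩))
  rw [ContinuousLinearMap.id_apply, map_smul, ← smul_sub, norm_smul, norm_inv,
    Real.norm_of_nonneg hpos.le, inv_mul_lt_iff₀ hpos] at h
  linarith [mul_comm (1 / ((m : ℝ) + 1)) (((n : ℝ) + 1) * (1 + ‖x‖))]

variable [TopologicalSpace.SeparableSpace B] [MeasurableSpace B] [BorelSpace B]

/-- For a finite measure with a finite `k`-th absolute moment, a space with the approximation
property has finite rank operators that converge to the identity almost everywhere, with `k`-th
powers of norms dominated by an integrable function. -/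
theorem HasApproximationProperty.exists_dominated_seq (hB : HasApproximationProperty B) (k : ℕ)
    (μ : Measure B) [IsFiniteMeasure μ] (hμ : Integrable (fun x => ‖x‖ ^ k) μ) :
    ∃ (F : ℕ → B →L[ℝ] B) (R : B → ℝ), (∀ m, IsFiniteRank (F m)) ∧ Integrable R μ ∧
      (∀ᵐ x ∂μ, ∀ m, ‖F m x‖ ^ k ≤ R x) ∧
      ∀ᵐ x ∂μ, Tendsto (fun m => F m x) atTop (𝓝 x) := by
  have : SecondCountableTopology B := UniformSpace.secondCountable_of_separable B
  have hint : Integrable (fun x : B => (1 + ‖x‖) ^ k) μ := by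
    refine (((integrable_const (1 : ℝ)).add hμ).const_mul (2 ^ (k - 1))).mono'
      (by fun_prop) (ae_of_all _ fun x => ?_)
    rw [Real.norm_of_nonneg (by positivity)]
    simpa using add_pow_le zero_le_one (norm_nonneg x) k
  -- Tightness is applied to `w μ`, not to `μ`, so that the compact sets control the `k`-th moment
  -- outside them.
  set w : B → ENNReal := fun x => ENNReal.ofReal ((1 + ‖x‖) ^ k) with hw
  have hwm : Measurable w := by fun_prop
  have hwfin : ∫⁻ x, w x ∂μ ≠ ⊤ := hint.lintegral_lt_top.ne
  have hνfin : IsFiniteMeasure (μ.withDensity w) := isFiniteMeasure_withDensity hwfin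
  obtain ⟨δ, hδ, hδsum⟩ := ENNReal.exists_pos_sum_of_countable' one_ne_zero ℕ
  have hKex : ∀ n : ℕ, ∃ K : Set B, IsCompact K ∧
      (μ.withDensity w) Kᶜ ≤ δ n / ((n : ENNReal) + 2) ^ k := by
    intro n
    have hpos : 0 < δ n / ((n : ENNReal) + 2) ^ k :=
      ENNReal.div_pos (hδ n).ne' (by finiteness)
    obtain ⟨K, hK, hle⟩ := isTightMeasureSet_iff_exists_isCompact_measure_compl_le.1
      (isTightMeasureSet_singleton (μ := μ.withDensity w)) _ hpos
    exact ⟨K, hK, hle _ rfl⟩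
  choose K hK hKδ using hKex
  -- `G` dominates `(n + 1) ^ k`, where `n` is the first index with `x ∈ K n`; the choice of `δ`
  -- makes `w * G` integrable.
  set G : B → ENNReal := fun x =>
    1 + ∑' n : ℕ, (K n)ᶜ.indicator (fun _ => ((n : ENNReal) + 2) ^ k) x with hG
  have him : ∀ n : ℕ, Measurable ((K n)ᶜ.indicator (fun _ : B => ((n : ENNReal) + 2) ^ k)) :=
    fun n => measurable_const.indicator (hK n).measurableSet.compl
  have hGm : Measurable G := measurable_const.add (Measurable.tsum him)
  have hGfin : ∫⁻ x, G x ∂(μ.withDensity w) ≠ ⊤ := by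
    rw [lintegral_add_left measurable_const, lintegral_tsum fun n => (him n).aemeasurable]
    refine ENNReal.add_ne_top.2 ⟨by simpa using hwfin, ?_⟩
    refine ne_top_of_le_ne_top (hδsum.trans ENNReal.one_lt_top).ne
      (ENNReal.tsum_le_tsum fun n => ?_)
    rw [lintegral_indicator_const (hK n).measurableSet.compl]
    calc ((n : ENNReal) + 2) ^ k * (μ.withDensity w) (K n)ᶜ
        ≤ ((n : ENNReal) + 2) ^ k * (δ n / ((n : ENNReal) + 2) ^ k) := by gcongr; exact hKδ n
      _ ≤ δ n := ENNReal.mul_div_le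
  have hHfin : ∫⁻ x, w x * G x ∂μ ≠ ⊤ := by
    rwa [lintegral_withDensity_eq_lintegral_mul _ hwm hGm] at hGfin
  have hGlt : ∀ᵐ x ∂μ, G x < ⊤ := by
    filter_upwards [ae_lt_top (hwm.mul hGm) hHfin] with x hx
    refine lt_of_le_of_lt ?_ hx
    have h1 : 1 ≤ w x := by
      rw [hw, ENNReal.one_le_ofReal]
      exact one_le_pow₀ (by linarith [norm_nonneg x])
    simpa using mul_le_mul_left h1 (G x)
  have hfirst : ∀ x, G x < ⊤ → ∃ n : ℕ, x ∈ K n ∧ ((n : ENNReal) + 1) ^ k ≤ G x := by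
    classical
    intro x hx
    have hex : ∃ n, x ∈ K n := by
      by_contra! hno
      refine hx.ne (top_unique ?_)
      calc (⊤ : ENNReal) = ∑' _ : ℕ, (1 : ENNReal) :=
            (ENNReal.tsum_const_eq_top_of_ne_zero one_ne_zero).symm
        _ ≤ ∑' n : ℕ, (K n)ᶜ.indicator (fun _ => ((n : ENNReal) + 2) ^ k) x := by
            refine ENNReal.tsum_le_tsum fun n => ?_
            rw [Set.indicator_of_mem (hno n)]
            exact one_le_pow₀ (le_add_left one_le_two)
        _ ≤ G x := le_add_self
    refine ⟨Nat.find hex, Nat.find_spec hex, ?_⟩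
    -- For first index `0` the summand `1` of `G` suffices; for `n + 1`, the point misses `K n`,
    -- whose term is `(n + 2) ^ k`.
    rcases hN : Nat.find hex with _ | n
    · simp [hG]
    · have hn : x ∈ (K n)ᶜ := Nat.find_min hex (by omega)
      calc (((n + 1 : ℕ) : ENNReal) + 1) ^ k
          = (K n)ᶜ.indicator (fun _ => ((n : ENNReal) + 2) ^ k) x := by
            rw [Set.indicator_of_mem hn, Nat.cast_succ, add_assoc, one_add_one_eq_two]
        _ ≤ ∑' n : ℕ, (K n)ᶜ.indicator (fun _ => ((n : ENNReal) + 2) ^ k) x :=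
            ENNReal.le_tsum n
        _ ≤ G x := le_add_self
  obtain ⟨F, hF, hFK⟩ := hB.exists_seq hK
  refine ⟨F, fun x => 2 ^ k * (w x * G x).toReal, hF,
    (integrable_toReal_of_lintegral_ne_top (hwm.mul hGm).aemeasurable hHfin).const_mul _, ?_, ?_⟩
  · filter_upwards [hGlt] with x hx m
    obtain ⟨n, hn, hle⟩ := hfirst x hx
    have h1 : ‖F m x‖ ≤ 2 * ((1 + ‖x‖) * ((n : ℝ) + 1)) := by
      have h2 := hFK m n x hn
      have h3 : ‖F m x‖ ≤ ‖x‖ + ‖x - F m x‖ := by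
        simpa using norm_sub_le x (x - F m x)
      have h4 : 1 / ((m : ℝ) + 1) ≤ 1 := by
        rw [div_le_one (by positivity)]
        linarith [(Nat.cast_nonneg m : (0 : ℝ) ≤ m)]
      have h5 := mul_le_mul_of_nonneg_right h4
        (by positivity : 0 ≤ ((n : ℝ) + 1) * (1 + ‖x‖))
      nlinarith [norm_nonneg x, mul_nonneg (Nat.cast_nonneg n : (0 : ℝ) ≤ n)
        (add_nonneg zero_le_one (norm_nonneg x))]
    have h6 : ((n : ℝ) + 1) ^ k ≤ (G x).toReal := by
      have := ENNReal.toReal_mono hx.ne hle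
      rwa [ENNReal.toReal_pow, ENNReal.toReal_add (by simp) (by simp), ENNReal.toReal_natCast,
        ENNReal.toReal_one] at this
    rw [ENNReal.toReal_mul, hw, ENNReal.toReal_ofReal (by positivity)]
    calc ‖F m x‖ ^ k ≤ (2 * ((1 + ‖x‖) * ((n : ℝ) + 1))) ^ k := by gcongr
      _ = 2 ^ k * ((1 + ‖x‖) ^ k * ((n : ℝ) + 1) ^ k) := by rw [mul_pow, mul_pow]
      _ ≤ 2 ^ k * ((1 + ‖x‖) ^ k * (G x).toReal) := by gcongr
  · filter_upwards [hGlt] with x hx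
    obtain ⟨n, hn, -⟩ := hfirst x hx
    rw [tendsto_iff_norm_sub_tendsto_zero]
    refine squeeze_zero (fun _ => norm_nonneg _)
      (fun m => (norm_sub_rev _ _).trans_le (hFK m n x hn)) ?_
    simpa using tendsto_one_div_add_atTop_nhds_zero_nat.mul_const (((n : ℝ) + 1) * (1 + ‖x‖))

end DominatedApproximation

/-! ### Multilinear forms along finite rank operators. -/

section FiniteRank

variable {B : Type*} [NormedAddCommGroup B] [NormedSpace ℝ B]

/-- A finite rank operator is a finite sum of operators `x ↦ ψ x • e`. -/
theorem IsFiniteRank.exists_eq_sum {F : B →L[ℝ] B} (hF : IsFiniteRank F) :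
    ∃ (d : ℕ) (ψ : Fin d → StrongDual ℝ B) (e : Fin d → B), ∀ x, F x = ∑ j, ψ j x • e j := by
  have : FiniteDimensional ℝ (LinearMap.range (F : B →ₗ[ℝ] B)) := hF
  let b := Module.finBasis ℝ (LinearMap.range (F : B →ₗ[ℝ] B))
  let F' : B →L[ℝ] LinearMap.range (F : B →ₗ[ℝ] B) :=
    F.codRestrict _ fun x => LinearMap.mem_range_self _ x
  refine ⟨_, fun j => (LinearMap.toContinuousLinearMap (b.coord j)).comp F', fun j => b j,
    fun x => ?_⟩
  have h := congrArg (Subtype.val) (b.sum_repr (F' x))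
  rw [Submodule.coe_sum] at h
  exact h.symm

/-- A `k`-linear form composed with a finite rank operator is, on the diagonal, a finite linear
combination of products of `k` functionals. -/
theorem IsFiniteRank.exists_multilinear_eq_sum {F : B →L[ℝ] B} (hF : IsFiniteRank F) {k : ℕ}
    (α : ContinuousMultilinearMap ℝ (fun _ : Fin k => B) ℝ) :
    ∃ (d : ℕ) (c : (Fin k → Fin d) → ℝ) (φ : (Fin k → Fin d) → Fin k → StrongDual ℝ B),
      ∀ x, α (fun _ => F x) = ∑ r, (∏ i, φ r i x) * c r := by
  obtain ⟨d, ψ, e, h⟩ := hF.exists_eq_sum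
  refine ⟨d, fun r => α fun i => e (r i), fun r i => ψ (r i), fun x => ?_⟩
  simp_rw [h]
  rw [α.map_sum]
  exact Finset.sum_congr rfl fun r _ => by rw [α.map_smul_univ, smul_eq_mul]

end FiniteRank

/-! ### Multilinear forms, projective moments and weak moments. -/

section Moments

variable {B : Type*} [NormedAddCommGroup B] [NormedSpace ℝ B]

theorem norm_diag_le {k : ℕ} (α : ContinuousMultilinearMap ℝ (fun _ : Fin k => B) ℝ) (x : B) :
    ‖α (fun _ => x)‖ ≤ ‖α‖ * ‖x‖ ^ k := by
  simpa using α.le_opNorm (fun _ => x)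

theorem continuous_diag {k : ℕ} (α : ContinuousMultilinearMap ℝ (fun _ : Fin k => B) ℝ) :
    Continuous (fun x : B => α (fun _ => x)) :=
  α.cont.comp (continuous_pi fun _ => continuous_id)

/-- The `k`-linear form `(x₁, …, xₖ) ↦ φ₁(x₁) ⋯ φₖ(xₖ)`. -/
noncomputable def prodForm {k : ℕ} (φ : Fin k → StrongDual ℝ B) :
    ContinuousMultilinearMap ℝ (fun _ : Fin k => B) ℝ :=
  (ContinuousMultilinearMap.mkPiAlgebra ℝ (Fin k) ℝ).compContinuousLinearMap φ

theorem prodForm_apply {k : ℕ} (φ : Fin k → StrongDual ℝ B) (x : Fin k → B) :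
    prodForm φ x = ∏ i, φ i (x i) := by
  simp [prodForm]

theorem tensorPow_eq_tprodL (k : ℕ) (x : B) :
    tensorPow k x = UniformSpace.Completion.toComplL (𝕜 := ℝ)
      (PiTensorProduct.tprodL ℝ fun _ : Fin k => x) := by
  rw [← ContinuousMultilinearMap.coe_coe, PiTensorProduct.tprodL_coe]
  rfl

theorem continuous_tensorPow (k : ℕ) : Continuous (tensorPow k : B → ProjTensorPower k B) := by
  simp_rw [funext (tensorPow_eq_tprodL (B := B) k)]
  exact (UniformSpace.Completion.toComplL (𝕜 := ℝ)).continuous.comp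
    ((PiTensorProduct.tprodL ℝ).cont.comp (continuous_pi fun _ => continuous_id))

theorem norm_tensorPow_le (k : ℕ) (x : B) : ‖tensorPow k x‖ ≤ ‖x‖ ^ k := by
  rw [tensorPow, UniformSpace.Completion.norm_coe]
  simpa using PiTensorProduct.projectiveSeminorm_tprod_le (𝕜 := ℝ) fun _ : Fin k => x

/-- A bounded `k`-linear form as a functional on the projective tensor power. -/
noncomputable def extendForm {k : ℕ} (α : ContinuousMultilinearMap ℝ (fun _ : Fin k => B) ℝ) :
    StrongDual ℝ (ProjTensorPower k B) :=
  (PiTensorProduct.liftIsometry ℝ (fun _ : Fin k => B) ℝ α).extend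
    (UniformSpace.Completion.toComplL (𝕜 := ℝ))

theorem extendForm_tensorPow {k : ℕ} (α : ContinuousMultilinearMap ℝ (fun _ : Fin k => B) ℝ)
    (x : B) : extendForm α (tensorPow k x) = α fun _ => x := by
  have h := ContinuousLinearMap.extend_eq
    (PiTensorProduct.liftIsometry ℝ (fun _ : Fin k => B) ℝ α)
    (e := UniformSpace.Completion.toComplL (𝕜 := ℝ))
    (UniformSpace.Completion.denseRange_coe)
    (UniformSpace.Completion.isUniformInducing_coe _) (⨂ₜ[ℝ] _ : Fin k, x)
  refine h.trans ?_
  rw [PiTensorProduct.liftIsometry_apply_apply, PiTensorProduct.lift.tprod]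
  rfl

variable [MeasurableSpace B] [BorelSpace B]

theorem integrable_diag {k : ℕ} {Ω : Type*} [MeasurableSpace Ω] {P : Measure Ω} {X : Ω → B}
    (hX : AEMeasurable X P) (hXk : Integrable (fun ω => ‖X ω‖ ^ k) P)
    (α : ContinuousMultilinearMap ℝ (fun _ : Fin k => B) ℝ) :
    Integrable (fun ω => α (fun _ => X ω)) P :=
  (hXk.const_mul ‖α‖).mono'
    ((continuous_diag α).measurable.comp_aemeasurable hX).aestronglyMeasurable
    (ae_of_all _ fun ω => norm_diag_le α (X ω))

variable [TopologicalSpace.SeparableSpace B]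

theorem integrable_tensorPow {k : ℕ} {Ω : Type*} [MeasurableSpace Ω] {P : Measure Ω} {X : Ω → B}
    (hX : AEMeasurable X P) (hXk : Integrable (fun ω => ‖X ω‖ ^ k) P) :
    Integrable (fun ω => tensorPow k (X ω)) P := by
  have : SecondCountableTopology B := UniformSpace.secondCountable_of_separable B
  exact hXk.mono' ((continuous_tensorPow k).comp_aestronglyMeasurable hX.aestronglyMeasurable)
    (ae_of_all _ fun ω => norm_tensorPow_le k (X ω))

/-- Bounded functionals commute with the Bochner integral; hence equal projective moments force
equal means of all forms. -/
theorem extendForm_projMoment {k : ℕ} {Ω : Type*} [MeasurableSpace Ω] {P : Measure Ω} {X : Ω → B}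
    (hX : AEMeasurable X P) (hXk : Integrable (fun ω => ‖X ω‖ ^ k) P)
    (α : ContinuousMultilinearMap ℝ (fun _ : Fin k => B) ℝ) :
    extendForm α (projMoment k P X) = ∫ ω, α (fun _ => X ω) ∂P := by
  rw [projMoment, ← ContinuousLinearMap.integral_comp_comm _ (integrable_tensorPow hX hXk)]
  simp_rw [extendForm_tensorPow]

/-- Projective moments are equal as soon as all bounded `k`-linear forms have equal means. -/
theorem projMoment_eq_of_forall_integral_eq {k : ℕ} {Ω Ω' : Type*} [MeasurableSpace Ω]
    [MeasurableSpace Ω'] {P : Measure Ω} {Q : Measure Ω'} {X : Ω → B} {Y : Ω' → B}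
    (hX : AEMeasurable X P) (hY : AEMeasurable Y Q)
    (hXk : Integrable (fun ω => ‖X ω‖ ^ k) P) (hYk : Integrable (fun ω => ‖Y ω‖ ^ k) Q)
    (h : ∀ α : ContinuousMultilinearMap ℝ (fun _ : Fin k => B) ℝ,
      ∫ ω, α (fun _ => X ω) ∂P = ∫ ω, α (fun _ => Y ω) ∂Q) :
    projMoment k P X = projMoment k Q Y := by
  -- By Hahn–Banach it suffices to test functionals, and each one composed with the tensor map is a
  -- bounded `k`-linear form.
  rw [SeparatingDual.eq_iff_forall_dual_eq (R := ℝ)]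
  intro g
  rw [projMoment, projMoment, ← g.integral_comp_comm (integrable_tensorPow hX hXk),
    ← g.integral_comp_comm (integrable_tensorPow hY hYk)]
  simp_rw [tensorPow_eq_tprodL]
  exact h ((g.comp (UniformSpace.Completion.toComplL (𝕜 := ℝ))).compContinuousMultilinearMap
    (PiTensorProduct.tprodL ℝ))

variable [CompleteSpace B]

/-- In a space with the approximation property, weak moments determine the means of all bounded
`k`-linear forms. -/
theorem HasApproximationProperty.integral_diag_eq (hB : HasApproximationProperty B) {k : ℕ}
    {μ ν : Measure B} [IsFiniteMeasure μ] [IsFiniteMeasure ν]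
    (hμ : Integrable (fun x => ‖x‖ ^ k) μ) (hν : Integrable (fun x => ‖x‖ ^ k) ν)
    (h : ∀ φ : Fin k → StrongDual ℝ B, ∫ x, ∏ i, φ i x ∂μ = ∫ x, ∏ i, φ i x ∂ν)
    (α : ContinuousMultilinearMap ℝ (fun _ : Fin k => B) ℝ) :
    ∫ x, α (fun _ => x) ∂μ = ∫ x, α (fun _ => x) ∂ν := by
  -- Using `μ + ν` gives one sequence and one bound valid for both measures.
  obtain ⟨F, R, hF, hR, hFR, hFt⟩ := hB.exists_dominated_seq k (μ + ν) (hμ.add_measure hν)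
  have key : ∀ ρ : Measure B, ρ ≤ μ + ν →
      Tendsto (fun m => ∫ x, α (fun _ => F m x) ∂ρ) atTop (𝓝 (∫ x, α (fun _ => x) ∂ρ)) := by
    intro ρ hρ
    refine tendsto_integral_of_dominated_convergence (fun x => ‖α‖ * R x) (fun m => ?_)
      ((hR.mono_measure hρ).const_mul _) (fun m => ?_) ?_
    · exact ((continuous_diag α).comp (F m).continuous).measurable.aestronglyMeasurable
    · filter_upwards [ae_mono hρ hFR] with x hx
      exact (norm_diag_le α _).trans (mul_le_mul_of_nonneg_left (hx m) (norm_nonneg _))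
    · filter_upwards [ae_mono hρ hFt] with x hx
      exact ((continuous_diag α).tendsto x).comp hx
  have hint : ∀ {ρ : Measure B}, Integrable (fun x => ‖x‖ ^ k) ρ →
      ∀ φ : Fin k → StrongDual ℝ B, Integrable (fun x => ∏ i, φ i x) ρ := by
    intro ρ hρ φ
    simpa only [prodForm_apply, id_eq] using integrable_diag aemeasurable_id hρ (prodForm φ)
  refine tendsto_nhds_unique (key μ (Measure.le_add_right le_rfl)) ?_
  refine (key ν (Measure.le_add_left le_rfl)).congr fun m => ?_
  obtain ⟨d, c, φ, hc⟩ := (hF m).exists_multilinear_eq_sum α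
  simp_rw [hc]
  rw [integral_finsetSum _ fun r _ => (hint hν (φ r)).mul_const (c r),
    integral_finsetSum _ fun r _ => (hint hμ (φ r)).mul_const (c r)]
  simp_rw [integral_mul_const, h]

end Moments

end BanachMoments

theorem theorem1p1 {B : Type*} [NormedAddCommGroup B] [NormedSpace ℝ B] [CompleteSpace B]
    [TopologicalSpace.SeparableSpace B] [MeasurableSpace B] [BorelSpace B]
    (hB : BanachMoments.HasApproximationProperty B)
    (k : ℕ) (hk : 1 ≤ k)
    {Ω : Type*} [MeasurableSpace Ω] (P : Measure Ω) [IsProbabilityMeasure P]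
    {Ω' : Type*} [MeasurableSpace Ω'] (Q : Measure Ω') [IsProbabilityMeasure Q]
    (X : Ω → B) (Y : Ω' → B) (hX : AEMeasurable X P) (hY : AEMeasurable Y Q)
    (hXk : Integrable (fun ω => ‖X ω‖ ^ k) P) (hYk : Integrable (fun ω => ‖Y ω‖ ^ k) Q) :
    -- all the expectations below exist (the weak ones are those of special `k`-linear forms)
    (Integrable (fun ω => BanachMoments.tensorPow k (X ω)) P ∧
      Integrable (fun ω => BanachMoments.tensorPow k (Y ω)) Q) ∧
    (∀ α : ContinuousMultilinearMap ℝ (fun _ : Fin k => B) ℝ,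
      Integrable (fun ω => α (fun _ => X ω)) P ∧ Integrable (fun ω => α (fun _ => Y ω)) Q) ∧
    (∀ φ : Fin k → StrongDual ℝ B,
      Integrable (fun ω => ∏ i, φ i (X ω)) P ∧ Integrable (fun ω => ∏ i, φ i (Y ω)) Q) ∧
    -- equality of moments against all bounded `k`-linear forms and weak equality are equivalent
    ((∀ α : ContinuousMultilinearMap ℝ (fun _ : Fin k => B) ℝ,
        ∫ ω, α (fun _ => X ω) ∂P = ∫ ω, α (fun _ => Y ω) ∂Q) ↔
      (∀ φ : Fin k → StrongDual ℝ B,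
        ∫ ω, ∏ i, φ i (X ω) ∂P = ∫ ω, ∏ i, φ i (Y ω) ∂Q)) ∧
    -- the projective moments agree if and only if the weak moments agree
    (BanachMoments.projMoment k P X = BanachMoments.projMoment k Q Y ↔
      BanachMoments.weakMoment k P X = BanachMoments.weakMoment k Q Y) := by
  have hα := fun α : ContinuousMultilinearMap ℝ (fun _ : Fin k => B) ℝ =>
    And.intro (BanachMoments.integrable_diag hX hXk α) (BanachMoments.integrable_diag hY hYk α)
  have hform : (∀ α : ContinuousMultilinearMap ℝ (fun _ : Fin k => B) ℝ,
        ∫ ω, α (fun _ => X ω) ∂P = ∫ ω, α (fun _ => Y ω) ∂Q) ↔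
      (∀ φ : Fin k → StrongDual ℝ B,
        ∫ ω, ∏ i, φ i (X ω) ∂P = ∫ ω, ∏ i, φ i (Y ω) ∂Q) := by
    refine ⟨fun h φ => ?_, fun h α => ?_⟩
    · simpa only [BanachMoments.prodForm_apply] using h (BanachMoments.prodForm φ)
    · have hm : AEStronglyMeasurable (fun x : B => ‖x‖ ^ k) (P.map X) :=
        (by fun_prop : Measurable fun x : B => ‖x‖ ^ k).aestronglyMeasurable
      have hm' : AEStronglyMeasurable (fun x : B => ‖x‖ ^ k) (Q.map Y) :=
        (by fun_prop : Measurable fun x : B => ‖x‖ ^ k).aestronglyMeasurable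
      have hdiag := fun (α : ContinuousMultilinearMap ℝ (fun _ : Fin k => B) ℝ) (ρ : Measure B) =>
        (BanachMoments.continuous_diag α).measurable.aestronglyMeasurable (μ := ρ)
      -- Passing to the laws on `B` puts both variables on a common space.
      have hlaw := hB.integral_diag_eq (k := k) (μ := P.map X) (ν := Q.map Y)
        ((integrable_map_measure hm hX).2 hXk) ((integrable_map_measure hm' hY).2 hYk)
        (fun φ => by
          have h1 := integral_map hX (hdiag (BanachMoments.prodForm φ) _)
          have h2 := integral_map hY (hdiag (BanachMoments.prodForm φ) _)
          simp only [BanachMoments.prodForm_apply] at h1 h2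
          rw [h1, h2, h φ]) α
      rwa [integral_map hX (hdiag α _), integral_map hY (hdiag α _)] at hlaw
  refine ⟨⟨BanachMoments.integrable_tensorPow hX hXk, BanachMoments.integrable_tensorPow hY hYk⟩,
    hα, fun φ => ?_, hform, fun h => ?_, fun h => ?_⟩
  · simpa only [BanachMoments.prodForm_apply] using hα (BanachMoments.prodForm φ)
  · refine funext (hform.1 fun α => ?_)
    rw [← BanachMoments.extendForm_projMoment hX hXk, h,
      BanachMoments.extendForm_projMoment hY hYk]
  · exact BanachMoments.projMoment_eq_of_forall_integral_eq hX hY hXk hYk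
      (hform.2 fun φ => congrFun h φ)
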